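/- There is an absolute constant $c>0$ such that the following holds for every $n\ge 0$, every Boolean function $f:\mathbb F_2^n\to\mathbb F_2$ that is neither a parity function nor the negation of one (that is, $f$ is not of the form $x\mapsto b+\sum_{i\in S}x_i$ with $S\subseteq\{1,\dots,n\}$ and $b\in\mathbb F_2$; in particular $f$ is not constant), and every integer $k\ge 1$: $$\mathsf C^{\oplus}_{\min}[f^{\circ k}]\ \ge\ c\cdot \mathsf C_{\min}[f]^{\,k-1}.$$ Here, for a Boolean function $g:\mathbb F_2^N\to\mathbb F_2$, the minimum certificate complexity $\mathsf C_{\min}[g]$ is the minimum over $x\in\mathbb F_2^N$ of the least codimension of a subcube (a set obtained by fixing some of the coordinates) that contains $x$ and on which $g$ is constant, and the parity kill number $\mathsf C^{\oplus}_{\min}[g]$ is the minimum over $x\in\mathbb F_2^N$ of the least codimension of an affine subspace of $\mathbb F_2^N$ that contains $x$ and on which $g$ is constant. The composition power $f^{\circ k}:\mathbb F_2^{n^k}\to\mathbb F_2$ is defined by $f^{\circ 1}=f$ and $f^{\circ (k+1)}(y^{(1)},\dots,y^{(n^k)})=f^{\circ k}\bigl(f(y^{(1)}),\dots,f(y^{(n^k)})\bigr)$,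 where $y^{(1)},\dots,y^{(n^k)}\in\mathbb F_2^n$. -/

import Mathlib

namespace ParityKill

/-- Boolean functions `F_2^ι → F_2` on input bits indexed by `ι`. -/
abbrev BoolFun (ι : Type*) : Type _ := (ι → ZMod 2) → ZMod 2

/-- `f` is constant on the set `A` of inputs. -/
def ConstantOn {ι : Type*} (f : BoolFun ι) (A : Set (ι → ZMod 2)) : Prop :=
  ∃ b : ZMod 2, ∀ y ∈ A, f y = b

/-- The subcube obtained by fixing the coordinates in `S` to their values in `a`.
Its codimension is the cardinality of `S`. -/
def subcube {ι : Type*} (S : Finset ι) (a : ι → ZMod 2) : Set (ι → ZMod 2) :=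
  {y | ∀ i ∈ S, y i = a i}

/-- The codimension of an affine subspace of `F_2^ι`. -/
noncomputable def codim {ι : Type*} [Fintype ι]
    (H : AffineSubspace (ZMod 2) (ι → ZMod 2)) : ℕ :=
  Module.finrank (ZMod 2) ((ι → ZMod 2) ⧸ H.direction)

/-- Certificate complexity of `f` at `x`: the least codimension of a subcube through `x` on which
`f` is constant. -/
noncomputable def cert {ι : Type*} [Fintype ι] (f : BoolFun ι) (x : ι → ZMod 2) : ℕ :=
  sInf {d : ℕ | ∃ (S : Finset ι) (a : ι → ZMod 2),
    x ∈ subcube S a ∧ ConstantOn f (subcube S a) ∧ S.card = d}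

/-- Parity certificate complexity of `f` at `x`: the least codimension of an affine subspace
through `x` on which `f` is constant. -/
noncomputable def parityCert {ι : Type*} [Fintype ι] (f : BoolFun ι) (x : ι → ZMod 2) : ℕ :=
  sInf {d : ℕ | ∃ H : AffineSubspace (ZMod 2) (ι → ZMod 2),
    x ∈ H ∧ ConstantOn f (H : Set (ι → ZMod 2)) ∧ codim H = d}

/-- Minimum certificate complexity. -/
noncomputable def certMin {ι : Type*} [Fintype ι] (f : BoolFun ι) : ℕ :=
  ⨅ x : ι → ZMod 2, cert f x

/-- Parity kill number (minimum parity certificate complexity). -/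
noncomputable def parityKill {ι : Type*} [Fintype ι] (f : BoolFun ι) : ℕ :=
  ⨅ x : ι → ZMod 2, parityCert f x

/-- `f` is a parity of some set of input bits, or the negation of one. The empty set is allowed,
so the constant functions are included. -/
def IsParity {ι : Type*} [Fintype ι] (f : BoolFun ι) : Prop :=
  ∃ (S : Finset ι) (b : ZMod 2), ∀ x : ι → ZMod 2, f x = b + ∑ i ∈ S, x i

/-- The composition `(f ∘ g)(y⁽¹⁾, …, y⁽ⁿ⁾) = f (g y⁽¹⁾, …, g y⁽ⁿ⁾)`, the input
being the concatenation of `n` blocks of `m` bits. -/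
def comp {n m : ℕ} (f : BoolFun (Fin n)) (g : BoolFun (Fin m)) : BoolFun (Fin (n * m)) :=
  fun y => f fun i => g fun j => y (finProdFinEquiv (i, j))

/-- The `k`-th composition power, a Boolean function on `n ^ k` bits; the zeroth power is the
identity function of one bit. -/
def compPow {n : ℕ} (f : BoolFun (Fin n)) : (k : ℕ) → BoolFun (Fin (n ^ k))
  | 0 => fun x => x ⟨0, Nat.one_pos⟩
  | k + 1 => comp (compPow f k) f

end ParityKill

/-!
The constant is `1 / 2`. Since `f^{∘k} = f^{∘(k-1)} ∘ f`, it suffices to combine two facts.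

* Minimum certificate complexity is supermultiplicative (`certMin_mul_le_certMin_comp`): a subcube on
  which `F ∘ g` is constant must fix at least `certMin g` bits in each block whose `g`-value it
  determines, and the blocks it determines form a certificate for `F`. Hence
  `certMin f ^ k ≤ certMin (f^{∘k})` (`certMin_pow_le_certMin_compPow`).
* If `g` is not a parity, then `certMin F ≤ 2 * parityKill (F ∘ g)`
  (`certMin_le_two_mul_parityKill_comp`).

For the second fact, a function that is not a parity has a coordinate `j` that matters at some input
`w` and does not matter at some other input `v` (`exists_mixed_coordinate`). Let `H` be an affine
subspace of codimension `d` on which `F ∘ g` is constant. There is a set `S` of at most `d` blocks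
whose bits alone can bring any point into `H`, whatever the other blocks are. Among the blocks
outside `S` there is a set `R`, again of size at most `d`, such that any change of the `j`-th bits
of the blocks outside `S` is, modulo the direction of `H`, a change of the `j`-th bits of the blocks
in `R`. Put `v` in the blocks of `R`, `w` in all other blocks outside `S`, and complete on `S` to a
point of `H`. Now the `g`-value of each block outside `S ∪ R` can be toggled by flipping its `j`-th
bit, and flipping `j`-th bits in `R`, which does not affect any `g`-value, restores membership in
`H`. So `F` is constant once the at most `2 * d` coordinates in `S ∪ R` are fixed
(`exists_small_determining_set`).
-/

namespace ParityKill

/-! ### Certificates attaining the minima -/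

theorem certMin_le_card {ι : Type*} [Fintype ι] {f : BoolFun ι} {S : Finset ι} {a : ι → ZMod 2}
    (h : ConstantOn f (subcube S a)) : certMin f ≤ S.card :=
  (ciInf_le (OrderBot.bddBelow _) a).trans
    (Nat.sInf_le ⟨S, a, fun _ _ => rfl, h, rfl⟩)

theorem exists_subcube_card_eq_certMin {ι : Type*} [Fintype ι] (f : BoolFun ι) :
    ∃ (S : Finset ι) (a : ι → ZMod 2), ConstantOn f (subcube S a) ∧ S.card = certMin f := by
  obtain ⟨x, hx⟩ := Nat.sInf_mem (Set.range_nonempty fun x : ι → ZMod 2 => cert f x)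
  have hne : {d : ℕ | ∃ (S : Finset ι) (a : ι → ZMod 2),
      x ∈ subcube S a ∧ ConstantOn f (subcube S a) ∧ S.card = d}.Nonempty :=
    ⟨_, Finset.univ, x, fun _ _ => rfl,
      ⟨f x, fun y hy => congrArg f (funext fun i => hy i (Finset.mem_univ i))⟩, rfl⟩
  obtain ⟨S, a, -, h, hc⟩ := Nat.sInf_mem hne
  exact ⟨S, a, h, hc.trans hx⟩

theorem exists_affineSubspace_codim_eq_parityKill {ι : Type*} [Fintype ι] (f : BoolFun ι) :
    ∃ (H : AffineSubspace (ZMod 2) (ι → ZMod 2)) (x : ι → ZMod 2),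
      x ∈ H ∧ ConstantOn f (H : Set (ι → ZMod 2)) ∧ codim H = parityKill f := by
  obtain ⟨x, hx⟩ := Nat.sInf_mem (Set.range_nonempty fun x : ι → ZMod 2 => parityCert f x)
  have hne : {d : ℕ | ∃ H : AffineSubspace (ZMod 2) (ι → ZMod 2),
      x ∈ H ∧ ConstantOn f (H : Set (ι → ZMod 2)) ∧ codim H = d}.Nonempty :=
    ⟨_, AffineSubspace.mk' x ⊥, AffineSubspace.self_mem_mk' x ⊥, ⟨f x, fun y hy => by
      rw [SetLike.mem_coe, AffineSubspace.mem_mk', Submodule.mem_bot, vsub_eq_sub,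
        sub_eq_zero] at hy
      rw [hy]⟩, rfl⟩
  obtain ⟨H, hH, h, hc⟩ := Nat.sInf_mem hne
  exact ⟨H, x, hH, h, hc.trans hx⟩

/-! ### Supermultiplicativity of the minimum certificate complexity -/

theorem exists_mem_subcube_apply_eq {ι : Type*} [Fintype ι] {g : BoolFun ι} {S : Finset ι}
    (hS : S.card < certMin g) (a : ι → ZMod 2) (b : ZMod 2) : ∃ y ∈ subcube S a, g y = b := by
  by_contra! hne
  refine hS.not_ge (certMin_le_card (a := a) ⟨b + 1, fun y hy => ?_⟩)
  have key : ∀ s t : ZMod 2, s ≠ t → s = t + 1 := by decide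
  exact key _ _ (hne y hy)

theorem certMin_mul_le_certMin_comp {n m : ℕ} (F : BoolFun (Fin n)) (g : BoolFun (Fin m)) :
    certMin F * certMin g ≤ certMin (comp F g) := by
  obtain ⟨S, a, ⟨b, hb⟩, hc⟩ := exists_subcube_card_eq_certMin (comp F g)
  let block : Fin n → Finset (Fin m) := fun i =>
    Finset.univ.filter fun j => finProdFinEquiv (i, j) ∈ S
  let T : Finset (Fin n) := Finset.univ.filter fun i => certMin g ≤ (block i).card
  have hsum : ∑ i, (block i).card = S.card := by
    simp only [block, Finset.card_filter]
    rw [← Fintype.sum_prod_type' (f := fun i j => if finProdFinEquiv (i, j) ∈ S then 1 else 0),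
      Equiv.sum_comp finProdFinEquiv (fun p => if p ∈ S then 1 else 0)]
    simp
  have hT : T.card * certMin g ≤ S.card := by
    rw [← hsum, ← smul_eq_mul]
    refine (Finset.card_nsmul_le_sum T _ _ fun i hi => (Finset.mem_filter.1 hi).2).trans ?_
    exact Finset.sum_le_sum_of_subset (Finset.subset_univ T)
  have hF : certMin F ≤ T.card := by
    refine certMin_le_card (a := fun i => g fun j => a (finProdFinEquiv (i, j)))
      ⟨b, fun z hz => ?_⟩
    have hex : ∀ i, ∃ y ∈ subcube (block i) (fun j => a (finProdFinEquiv (i, j))), g y = z i := by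
      intro i
      by_cases hi : i ∈ T
      · exact ⟨_, fun _ _ => rfl, (hz i hi).symm⟩
      · exact exists_mem_subcube_apply_eq (by simpa [T] using hi) _ _
    choose Y hY hgY using hex
    have hval := hb (fun p => Y (finProdFinEquiv.symm p).1 (finProdFinEquiv.symm p).2) (by
      intro p hp
      obtain ⟨⟨i, j⟩, rfl⟩ := finProdFinEquiv.surjective p
      simp only [Equiv.symm_apply_apply]
      exact hY i j (by simpa [block] using hp))
    simpa only [comp, Equiv.symm_apply_apply, hgY] using hval
  calc certMin F * certMin g ≤ T.card * certMin g := Nat.mul_le_mul_right _ hF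
    _ ≤ certMin (comp F g) := hT.trans hc.le

theorem certMin_pow_le_certMin_compPow {n : ℕ} (f : BoolFun (Fin n)) (k : ℕ) :
    certMin f ^ k ≤ certMin (compPow f k) := by
  induction k with
  | zero =>
    obtain ⟨S, a, ⟨b, hb⟩, hc⟩ := exists_subcube_card_eq_certMin (compPow f 0)
    rw [pow_zero, ← hc, Nat.one_le_iff_ne_zero, Ne, Finset.card_eq_zero]
    rintro rfl
    have h0 : (0 : ZMod 2) = b := hb (fun _ => 0) fun i hi => absurd hi (Finset.notMem_empty i)
    have h1 : (1 : ZMod 2) = b := hb (fun _ => 1) fun i hi => absurd hi (Finset.notMem_empty i)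
    exact zero_ne_one (h0.trans h1.symm)
  | succ k ih =>
    rw [pow_succ]
    exact (Nat.mul_le_mul_right _ ih).trans (certMin_mul_le_certMin_comp _ _)

/-! ### Functions that are not parities -/

/-- A coordinate that matters everywhere or nowhere acts additively, so a function all of whose
coordinates are of this kind is a parity. -/
theorem exists_mixed_coordinate {ι : Type*} [Fintype ι] [DecidableEq ι] {g : BoolFun ι}
    (hg : ¬ IsParity g) :
    ∃ (j : ι) (v w : ι → ZMod 2), (∀ c, g (v + Pi.single j c) = g v) ∧
      ∀ b, ∃ c, g (w + Pi.single j c) = b := by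
  by_contra! hno
  have hadd : ∀ j, ∃ s : ZMod 2, ∀ x c, g (x + Pi.single j c) = g x + s * c := by
    have cases2 : ∀ c : ZMod 2, c = 0 ∨ c = 1 := by decide
    have hflip : ∀ s t : ZMod 2, s ≠ t → s = t + 1 := by decide
    intro j
    by_cases hj : ∃ v, ∀ c, g (v + Pi.single j c) = g v
    · obtain ⟨v, hv⟩ := hj
      refine ⟨0, fun x c => ?_⟩
      obtain ⟨b, hb⟩ := hno j v x hv
      have h0 := hflip _ _ (hb 0)
      rw [Pi.single_zero, add_zero] at h0
      rw [hflip _ _ (hb c), h0, zero_mul, add_zero]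
    · push Not at hj
      refine ⟨1, fun x c => ?_⟩
      obtain ⟨d, hd⟩ := hj x
      rcases cases2 d with rfl | rfl
      · simp at hd
      · rcases cases2 c with rfl | rfl
        · simp
        · rw [hflip _ _ hd, mul_one]
  choose s hs using hadd
  have hsum : ∀ (x : ι → ZMod 2) (t : Finset ι),
      g (∑ j ∈ t, Pi.single j (x j)) = g 0 + ∑ j ∈ t, s j * x j := by
    intro x t
    induction t using Finset.induction_on with
    | empty => simp
    | insert j t hj ih =>
      rw [Finset.sum_insert hj, Finset.sum_insert hj, add_comm, hs, ih, add_assoc,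
        add_comm (s j * x j)]
  refine hg ⟨Finset.univ.filter fun j => s j = 1, g 0, fun x => ?_⟩
  have hx := hsum x Finset.univ
  rw [Finset.univ_sum_single] at hx
  rw [hx, Finset.sum_filter]
  have key : ∀ a b : ZMod 2, a * b = if a = 1 then b else 0 := by decide
  simp only [key]

/-! ### Parity kill number of a composition -/

/-- Among the images of linear maps into `Q`, at most `dim Q` suffice to span the sum of all. -/
theorem exists_small_spanning_subset {K Q E ι : Type*} [Field K] [AddCommGroup Q] [Module K Q]
    [FiniteDimensional K Q] [AddCommGroup E] [Module K E] [DecidableEq ι]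
    (u : ι → E →ₗ[K] Q) (t : Finset ι) :
    ∃ s ⊆ t, s.card ≤ Module.finrank K Q ∧
      ∀ x : ι → E, ∃ x' : ι → E, ∑ i ∈ t, u i (x i) = ∑ i ∈ s, u i (x' i) := by
  have hsup : ∃ s ⊆ t, s.card ≤ Module.finrank K ↥(⨆ i ∈ t, LinearMap.range (u i)) ∧
      ⨆ i ∈ t, LinearMap.range (u i) = ⨆ i ∈ s, LinearMap.range (u i) := by
    induction t using Finset.induction_on with
    | empty => exact ⟨∅, subset_rfl, by simp, rfl⟩
    | insert j t hj ih =>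
      obtain ⟨s, hst, hcard, heq⟩ := ih
      by_cases hle : LinearMap.range (u j) ≤ ⨆ i ∈ t, LinearMap.range (u i)
      · refine ⟨s, hst.trans (Finset.subset_insert _ _), ?_⟩
        rw [Finset.iSup_insert, sup_eq_right.2 hle]
        exact ⟨hcard, heq⟩
      · refine ⟨insert j s, Finset.insert_subset_insert _ hst, ?_⟩
        rw [Finset.iSup_insert, Finset.iSup_insert, ← heq]
        refine ⟨?_, rfl⟩
        rw [Finset.card_insert_of_notMem fun h => hj (hst h)]
        exact hcard.trans_lt (Submodule.finrank_lt_finrank_of_lt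
          (right_lt_sup.2 hle))
  obtain ⟨s, hst, hcard, heq⟩ := hsup
  refine ⟨s, hst, hcard.trans (Submodule.finrank_le _), fun x => ?_⟩
  have hmem : ∑ i ∈ t, u i (x i) ∈ ⨆ i ∈ s, LinearMap.range (u i) := by
    rw [← heq]
    exact Submodule.sum_mem _ fun i hi =>
      Submodule.mem_iSup_of_mem i (Submodule.mem_iSup_of_mem hi ⟨x i, rfl⟩)
  obtain ⟨μ, hμ⟩ := (Submodule.mem_iSup_finset_iff_exists_sum _ _).1 hmem
  choose x' hx' using fun i => (μ i).2
  exact ⟨x', by rw [← hμ]; simp only [hx']⟩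

/-- A linear system `Λ Y = q` of rank `d` on blocks `Y i` restricts the tuple of values `g (Y i)`
in a weak sense only: for a suitable solution `Y₀`, after fixing at most `2 * d` of these values
to those of `Y₀`, the others are arbitrary. -/
theorem exists_small_determining_set {ι κ Q : Type*} [Fintype ι] [DecidableEq ι] [DecidableEq κ]
    [AddCommGroup Q] [Module (ZMod 2) Q] [FiniteDimensional (ZMod 2) Q]
    (Λ : (ι → κ → ZMod 2) →ₗ[ZMod 2] Q) (hΛ : Function.Surjective Λ) (q : Q)
    {g : BoolFun κ} {j : κ} {v w : κ → ZMod 2} (hv : ∀ c, g (v + Pi.single j c) = g v)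
    (hw : ∀ b, ∃ c, g (w + Pi.single j c) = b) :
    ∃ (S : Finset ι) (Y₀ : ι → κ → ZMod 2), S.card ≤ 2 * Module.finrank (ZMod 2) Q ∧
      ∀ z : ι → ZMod 2, (∀ i ∈ S, z i = g (Y₀ i)) → ∃ Y, Λ Y = q ∧ ∀ i, g (Y i) = z i := by
  let U : ι → (κ → ZMod 2) →ₗ[ZMod 2] Q := fun i =>
    Λ ∘ₗ LinearMap.single (ZMod 2) (fun _ => κ → ZMod 2) i
  let u : ι → ZMod 2 →ₗ[ZMod 2] Q := fun i => U i ∘ₗ LinearMap.single (ZMod 2) (fun _ => ZMod 2) j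
  have hsum : ∀ Y, Λ Y = ∑ i, U i (Y i) := fun Y => by
    conv_lhs => rw [← Finset.univ_sum_single Y, map_sum]
    rfl
  obtain ⟨S, -, hS, hspanS⟩ := exists_small_spanning_subset U Finset.univ
  obtain ⟨R, hRS, hR, hspanR⟩ := exists_small_spanning_subset u Sᶜ
  have hdisj : ∀ i ∈ R, i ∉ S := fun i hi => Finset.mem_compl.1 (hRS hi)
  obtain ⟨X, hX⟩ := hΛ (q - ∑ i ∈ Sᶜ, U i (if i ∈ R then v else w))
  obtain ⟨X', hX'⟩ := hspanS X
  let Y₀ : ι → κ → ZMod 2 := fun i => if i ∈ S then X' i else if i ∈ R then v else w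
  have hY₀ : Λ Y₀ = q := by
    rw [hsum, ← Finset.sum_add_sum_compl S]
    have h1 : ∑ i ∈ S, U i (Y₀ i) = ∑ i ∈ S, U i (X' i) :=
      Finset.sum_congr rfl fun i hi => by simp only [Y₀, if_pos hi]
    have h2 : ∑ i ∈ Sᶜ, U i (Y₀ i) = ∑ i ∈ Sᶜ, U i (if i ∈ R then v else w) :=
      Finset.sum_congr rfl fun i hi => by simp only [Y₀, if_neg (Finset.mem_compl.1 hi)]
    rw [h1, h2, ← hX', ← hsum, hX, sub_add_cancel]
  refine ⟨S ∪ R, Y₀, ?_, fun z hz => ?_⟩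
  · exact (Finset.card_union_le S R).trans (by omega)
  choose c hc using fun i => hw (z i)
  -- `c` toggles the blocks outside `S ∪ R` to their prescribed values, `c'` is the compensation.
  obtain ⟨c', hc'⟩ := hspanR fun i => if i ∈ R then 0 else c i
  let e : ι → ZMod 2 := fun i => if i ∈ S then 0 else if i ∈ R then -c' i else c i
  refine ⟨fun i => Y₀ i + Pi.single j (e i), ?_, fun i => ?_⟩
  · have hsplit : Λ (fun i => Y₀ i + Pi.single j (e i)) = q + ∑ i, u i (e i) := by
      rw [← hY₀, hsum, hsum, ← Finset.sum_add_distrib]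
      exact Finset.sum_congr rfl fun i _ => map_add (U i) _ _
    have hzero : ∑ i ∈ S, u i (e i) = 0 :=
      Finset.sum_eq_zero fun i hi => by simp only [e, if_pos hi, map_zero]
    have hrest : ∑ i ∈ Sᶜ, u i (e i) = 0 := by
      rw [← Finset.sum_sdiff hRS] at hc' ⊢
      have h1 : ∑ i ∈ Sᶜ \ R, u i (e i) = ∑ i ∈ Sᶜ \ R, u i (if i ∈ R then 0 else c i) :=
        Finset.sum_congr rfl fun i hi => by
          obtain ⟨hiS, hiR⟩ := Finset.mem_sdiff.1 hi
          simp only [e, if_neg (Finset.mem_compl.1 hiS), if_neg hiR]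
      have h2 : ∑ i ∈ R, u i (e i) = -∑ i ∈ R, u i (c' i) := by
        rw [← Finset.sum_neg_distrib]
        exact Finset.sum_congr rfl fun i hi => by
          simp only [e, if_neg (hdisj i hi), if_pos hi, map_neg]
      have h3 : ∑ i ∈ R, u i (if i ∈ R then 0 else c i) = 0 :=
        Finset.sum_eq_zero fun i hi => by rw [if_pos hi, map_zero]
      rw [h3, add_zero] at hc'
      rw [h1, h2, hc', add_neg_cancel]
    rw [hsplit, ← Finset.sum_add_sum_compl S, hzero, hrest, add_zero, add_zero]
  · by_cases hiS : i ∈ S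
    · rw [hz i (Finset.mem_union_left _ hiS)]
      simp only [e, if_pos hiS, Pi.single_zero, add_zero]
    · by_cases hiR : i ∈ R
      · rw [hz i (Finset.mem_union_right _ hiR)]
        simp only [Y₀, if_neg hiS, if_pos hiR, hv]
      · simp only [Y₀, e, if_neg hiS, if_neg hiR, hc]

theorem certMin_le_two_mul_parityKill_comp {n m : ℕ} (F : BoolFun (Fin n)) {g : BoolFun (Fin m)}
    (hg : ¬ IsParity g) : certMin F ≤ 2 * parityKill (comp F g) := by
  obtain ⟨H, x, hx, ⟨b, hb⟩, hc⟩ := exists_affineSubspace_codim_eq_parityKill (comp F g)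
  obtain ⟨j, v, w, hv, hw⟩ := exists_mixed_coordinate hg
  let flatten : (Fin n → Fin m → ZMod 2) →ₗ[ZMod 2] (Fin (n * m) → ZMod 2) :=
    { toFun := fun Y p => Y (finProdFinEquiv.symm p).1 (finProdFinEquiv.symm p).2
      map_add' := fun _ _ => rfl
      map_smul' := fun _ _ => rfl }
  have hflat : Function.Surjective flatten := fun y =>
    ⟨fun i k => y (finProdFinEquiv (i, k)), funext fun p =>
      congrArg y (finProdFinEquiv.apply_symm_apply p)⟩
  obtain ⟨S, Y₀, hS, hY⟩ := exists_small_determining_set (H.direction.mkQ ∘ₗ flatten)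
    (H.direction.mkQ_surjective.comp hflat) (H.direction.mkQ x) hv hw
  rw [← hc]
  refine (certMin_le_card (a := fun i => g (Y₀ i)) ⟨b, fun z hz => ?_⟩).trans hS
  obtain ⟨Y, hΛ, hgY⟩ := hY z hz
  have hmem : flatten Y ∈ H := by
    rw [← AffineSubspace.vsub_right_mem_direction_iff_mem hx, vsub_eq_sub]
    exact (Submodule.Quotient.eq _).1 hΛ
  have hval : F (fun i => g (Y i)) = b := by
    have hblock : ∀ i k, flatten Y (finProdFinEquiv (i, k)) = Y i k := fun i k => by
      simp only [flatten, LinearMap.coe_mk, AddHom.coe_mk, Equiv.symm_apply_apply]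
    simpa only [comp, hblock] using hb _ hmem
  simpa only [hgY] using hval

end ParityKill

theorem theorem3 :
    ∃ c : ℝ, 0 < c ∧ ∀ (n : ℕ) (f : ParityKill.BoolFun (Fin n)), ¬ ParityKill.IsParity f →
      ∀ k : ℕ, 1 ≤ k →
        c * (ParityKill.certMin f : ℝ) ^ (k - 1)
          ≤ (ParityKill.parityKill (ParityKill.compPow f k) : ℝ) := by
  refine ⟨1 / 2, by norm_num, fun n f hf k hk => ?_⟩
  obtain ⟨k, rfl⟩ := Nat.exists_eq_add_of_le' hk
  have h : ParityKill.certMin f ^ k ≤ 2 * ParityKill.parityKill (ParityKill.compPow f (k + 1)) :=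
    (ParityKill.certMin_pow_le_certMin_compPow f k).trans
      (ParityKill.certMin_le_two_mul_parityKill_comp (ParityKill.compPow f k) hf)
  have h' : (ParityKill.certMin f : ℝ) ^ k ≤
      2 * (ParityKill.parityKill (ParityKill.compPow f (k + 1)) : ℝ) := by exact_mod_cast h
  rw [Nat.add_sub_cancel]
  linarith
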